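/- Let $\mathcal H_0$ be a separable complex Hilbert space and $\mathcal L_b(\mathcal H_0)$ the Banach algebra of its bounded operators, with the operator norm. For $D\in\mathcal L_b(\mathcal H_0)$ and $w\in\mathbb C\setminus(-\infty,0]$ put $w^D=\exp(D\ln w)=\sum_{j\ge 0}\frac{1}{j!}(D\ln w)^j$, where $\ln$ is the principal logarithm. Let $N\in\mathcal L_b(\mathcal H_0)$ be normal, diagonalized as a multiplication operator: $(\mathsf V,\mathcal V,\xi)$ is a $\sigma$-finite measure space, $U:\mathcal H_0\to L^2(\mathsf V,\mathcal V,\xi)$ is a unitary operator and $\mathrm n\in L^\infty(\mathsf V,\mathcal V,\xi)$ is such that $UNU^{-1}f=\mathrm n f$ for every $f\in L^2(\mathsf V,\mathcal V,\xi)$. Define $$\varrho=\operatorname*{ess\,inf}_{v\in\mathsf V}\,\Re(\mathrm n(v))$$ with respect to $\xi$ (with the convention $\varrho=0$ in the trivial case $\xi=0$, that is, $\mathcal H_0=\{0\}$). Then there exist $C\in\mathcal L_b(\mathcal H_0)$ and a sequence $(\Delta_k)_{k\ge 0}$ in $\mathcal L_b(\mathcal H_0)$ with $\|\Delta_k\|=O(k^{-1-\varrho})$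 as $k\to\infty$ such that, for all $z\in\mathbb C$ with $|z|<1$, $$(1-z)^{N-\mathrm{Id}}=C\left(\sum_{k=0}^\infty (k+1)^{-N}z^k\right)+\sum_{k=0}^\infty\Delta_k z^k, \qquad (*)$$ where the two infinite sums on the right-hand side are $\mathcal L_b(\mathcal H_0)$-valued power series with radius of convergence at least $1$. Moreover, if $\varrho>0$, then, with the same $C$ and $(\Delta_k)$, identity $(*)$ continues to hold for all $z\in\mathbb C$ with $|z|\le 1$ and $z\ne 1$, the two infinite sums (as limits of their partial sums) converging in $\mathcal L_b(\mathcal H_0)$. -/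

import Mathlib

open Filter Topology MeasureTheory Asymptotics
open scoped ENNReal

noncomputable section

namespace Fiarma

/-- The operator power `w ^ D = exp (D ln w)`, with `ln` the principal complex logarithm and
`exp` the exponential power series in the Banach algebra of bounded operators. It is meant for
`w` off the closed negative real half-line. -/
def opPow {H : Type*} [NormedAddCommGroup H] [InnerProductSpace ℂ H]
    (w : ℂ) (D : H →L[ℂ] H) : H →L[ℂ] H :=
  NormedSpace.exp (Complex.log w • D)

/-- `N` has singular value function `n` on `L²(V, ξ)` with decomposition operator `U`: here `U` is
a unitary operator from `H` onto `L²(V, ξ)`, `n` is in `L^∞(V, ξ)`, and `U N U⁻¹` is the operator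
`f ↦ n f` of pointwise multiplication by `n`. -/
def HasSingularValueFunction {H : Type*} [NormedAddCommGroup H] [InnerProductSpace ℂ H]
    {V : Type*} [MeasurableSpace V] (N : H →L[ℂ] H) (ξ : Measure V) (n : V → ℂ)
    (U : H ≃ₗᵢ[ℂ] Lp ℂ 2 ξ) : Prop :=
  MemLp n ∞ ξ ∧ ∀ f : Lp ℂ 2 ξ, (U (N (U.symm f)) : V → ℂ) =ᵐ[ξ] fun v => n v * f v

/-- The power series `∑ z ^ k • a k` in one complex variable with coefficients in `E`. -/
def powerSeries {E : Type*} [NormedAddCommGroup E] [NormedSpace ℂ E] (a : ℕ → E) :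
    FormalMultilinearSeries ℂ ℂ E :=
  fun k => ContinuousMultilinearMap.mkPiRing ℂ (Fin k) (a k)

/-- The series `∑ a k` converges in norm to `S`, in the sense that its partial sums do (the
convergence need not be absolute or unconditional). -/
def SeriesTendsTo {E : Type*} [NormedAddCommGroup E] (a : ℕ → E) (S : E) : Prop :=
  Tendsto (fun m : ℕ => ∑ k ∈ Finset.range m, a k) atTop (𝓝 S)

end Fiarma

end

namespace Fiarma

/-! ### Sequences and power series in a normed space -/

section Sequences

variable {E : Type*} [NormedAddCommGroup E]

/-! The Taylor coefficients of `(1 - z) ^ (N - 1)` are `a k = ∏ j ≤ k, (1 - N / j)`. The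
renormalized `b k = a k * (k + 1) ^ N` has relative increments `O(1 / k ^ 2)`, because `(1 - t N) (1
+ t) ^ N = 1 + O(t ^ 2)`, so it converges to some `C` at rate `O(1 / k)`
(`exists_norm_binomCoeff_mul_opPow_sub_le`). Put `Δ k = a k - C (k + 1) ^ (-N) = (b k - C) (k + 1) ^
(-N)`. The multiplication model bounds the numerical range of `N` below by `ϱ`, whence `‖(k + 1) ^
(-N)‖ ≤ (k + 1) ^ (-ϱ)` (`norm_exp_smul_neg_le`) and the rate of `Δ`. If `ϱ > 0`, `∑ ‖Δ k‖`
converges, and Abel summation handles the other series on the closed disc off `1`. Both sides are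
continuous there and agree inside, hence agree on the boundary. -/

lemma inv_sq_le_two_mul_sub (k : ℕ) :
    1 / ((k : ℝ) + 1) ^ 2 ≤ 2 * (1 / ((k : ℝ) + 1) - 1 / ((k : ℝ) + 1 + 1)) := by
  have hk : (0 : ℝ) ≤ k := k.cast_nonneg
  have : 2 * (1 / ((k : ℝ) + 1) - 1 / ((k : ℝ) + 1 + 1)) = 2 / (((k : ℝ) + 1) * (k + 1 + 1)) := by
    field_simp
    ring
  rw [this, div_le_div_iff₀ (by positivity) (by positivity)]
  nlinarith

/-- A sequence whose relative increments are `O(1 / k ^ 2)` converges with rate `O(1 / k)`. -/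
lemma exists_norm_sub_le_of_norm_succ_sub_le [CompleteSpace E] {b : ℕ → E} {K : ℝ} (hK : 0 ≤ K)
    (hb : ∀ k : ℕ, ‖b (k + 1) - b k‖ ≤ K * (1 / ((k : ℝ) + 1)) ^ 2 * ‖b k‖) :
    ∃ (C : E) (M : ℝ), 0 ≤ M ∧ ∀ k : ℕ, ‖b k - C‖ ≤ M / ((k : ℝ) + 1) := by
  -- Increments are controlled only relative to `‖b k‖`, so boundedness comes first: a discrete
  -- Grönwall bound whose exponent telescopes.
  have hbd : ∀ k : ℕ, ‖b k‖ ≤ ‖b 0‖ * Real.exp (2 * K * (1 - 1 / ((k : ℝ) + 1))) := by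
    intro k
    induction k with
    | zero => simp
    | succ k ih =>
      have h1 : ‖b (k + 1)‖ ≤ (1 + K * (1 / ((k : ℝ) + 1)) ^ 2) * ‖b k‖ := by
        have := norm_le_norm_add_norm_sub' (b (k + 1)) (b k)
        linarith [hb k]
      have h2 : 1 + K * (1 / ((k : ℝ) + 1)) ^ 2 ≤
          Real.exp (2 * K * (1 / ((k : ℝ) + 1) - 1 / ((k : ℝ) + 1 + 1))) := by
        refine le_trans ?_ (Real.add_one_le_exp _)
        have := mul_le_mul_of_nonneg_left (inv_sq_le_two_mul_sub k) hK
        rw [one_div_pow]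
        linarith
      calc ‖b (k + 1)‖ ≤ _ := h1
        _ ≤ _ := mul_le_mul h2 ih (norm_nonneg _) (Real.exp_nonneg _)
        _ = _ := by
          rw [mul_left_comm, ← Real.exp_add]
          push_cast
          ring_nf
  set B := ‖b 0‖ * Real.exp (2 * K) with hB
  have hB0 : 0 ≤ B := by positivity
  have hbB : ∀ k, ‖b k‖ ≤ B := fun k => (hbd k).trans <| by
    have : (0 : ℝ) ≤ 1 / ((k : ℝ) + 1) := by positivity
    exact mul_le_mul_of_nonneg_left (Real.exp_le_exp.2 (by nlinarith)) (norm_nonneg _)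
  have hinc : ∀ k m : ℕ, ‖b (k + m) - b k‖ ≤
      2 * K * B * (1 / ((k : ℝ) + 1) - 1 / (((k + m : ℕ) : ℝ) + 1)) := by
    intro k m
    induction m with
    | zero => simp
    | succ m ih =>
      have h1 : ‖b (k + m + 1) - b (k + m)‖ ≤
          K * B * (1 / (((k + m : ℕ) : ℝ) + 1) ^ 2) := by
        refine (hb (k + m)).trans ?_
        rw [one_div_pow, mul_right_comm]
        gcongr
        exact hbB _
      have h2 := mul_le_mul_of_nonneg_left (inv_sq_le_two_mul_sub (k + m)) (mul_nonneg hK hB0)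
      have h3 := norm_sub_le_norm_sub_add_norm_sub (b (k + m + 1)) (b (k + m)) (b k)
      rw [← add_assoc, Nat.cast_succ (k + m)]
      linarith
  have hinc' : ∀ k m : ℕ, k ≤ m → ‖b m - b k‖ ≤ 2 * K * B / ((k : ℝ) + 1) := by
    intro k m hkm
    obtain ⟨j, rfl⟩ := Nat.exists_eq_add_of_le hkm
    refine (hinc k j).trans ?_
    rw [div_eq_mul_one_div (2 * K * B)]
    have : (0 : ℝ) ≤ 1 / (((k + j : ℕ) : ℝ) + 1) := by positivity
    exact mul_le_mul_of_nonneg_left (by linarith) (by positivity)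
  have hcau : CauchySeq b := by
    refine cauchySeq_of_le_tendsto_0' (fun k : ℕ => 2 * K * B / ((k : ℝ) + 1)) ?_ ?_
    · intro k m hkm
      rw [dist_comm, dist_eq_norm]
      exact hinc' k m hkm
    · have := (tendsto_one_div_add_atTop_nhds_zero_nat (𝕜 := ℝ)).const_mul (2 * K * B)
      simpa [div_eq_mul_inv] using this
  obtain ⟨C, hC⟩ := cauchySeq_tendsto_of_complete hcau
  refine ⟨C, 2 * K * B, by positivity, fun k => ?_⟩
  rw [norm_sub_rev]
  exact le_of_tendsto ((hC.sub_const (b k)).norm)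
    (eventually_atTop.2 ⟨k, fun m hm => hinc' k m hm⟩)

lemma isBigO_add_one_rpow (s : ℝ) :
    (fun k : ℕ => ((k : ℝ) + 1) ^ s) =O[atTop] fun k : ℕ => (k : ℝ) ^ s := by
  refine IsBigO.of_bound (max 1 (2 ^ s)) (eventually_atTop.2 ⟨1, fun k hk => ?_⟩)
  have hk1 : (1 : ℝ) ≤ k := by exact_mod_cast hk
  rw [Real.norm_of_nonneg (by positivity), Real.norm_of_nonneg (by positivity)]
  have hks : (0 : ℝ) ≤ (k : ℝ) ^ s := by positivity
  rcases le_total s 0 with hs | hs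
  · have := Real.rpow_le_rpow_of_nonpos (by linarith) (by linarith : (k : ℝ) ≤ k + 1) hs
    nlinarith [le_max_left (1 : ℝ) (2 ^ s)]
  · have := Real.rpow_le_rpow (by positivity) (by linarith : (k : ℝ) + 1 ≤ 2 * k) hs
    rw [Real.mul_rpow (by norm_num) (by positivity)] at this
    nlinarith [le_max_right (1 : ℝ) (2 ^ s)]

variable [NormedSpace ℂ E]

lemma summable_pow_smul_of_norm_le_rpow [CompleteSpace E] {c : ℕ → E} {s : ℝ}
    (hc : ∀ k : ℕ, ‖c k‖ ≤ ((k : ℝ) + 1) ^ s) {z : ℂ} (hz : ‖z‖ < 1) :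
    Summable fun k : ℕ => z ^ k • c k := by
  obtain ⟨m, hm⟩ := exists_nat_ge s
  -- Undoing the index shift divides by the ratio, and `z` may be `0`; hence an intermediate `r >
  -- 0`.
  obtain ⟨r, hr1, hr2⟩ := exists_between hz
  have hr0 : 0 < r := (norm_nonneg z).trans_lt hr1
  have h1 : Summable fun k : ℕ => (((k + 1 : ℕ) : ℝ) ^ m * r ^ (k + 1)) * r⁻¹ :=
    ((summable_nat_add_iff (f := fun k : ℕ => (k : ℝ) ^ m * r ^ k) 1).2
      (summable_pow_mul_geometric_of_norm_lt_one m
        (by rwa [Real.norm_of_nonneg hr0.le]))).mul_right _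
  refine Summable.of_norm_bounded h1 fun k => ?_
  have h2 : ((k : ℝ) + 1) ^ s ≤ ((k : ℝ) + 1) ^ m := by
    rw [← Real.rpow_natCast]
    exact Real.rpow_le_rpow_of_exponent_le (by linarith [k.cast_nonneg (α := ℝ)]) hm
  have h3 : (((k + 1 : ℕ) : ℝ) ^ m * r ^ (k + 1)) * r⁻¹ = r ^ k * ((k : ℝ) + 1) ^ m := by
    rw [pow_succ]
    push_cast
    field_simp
  rw [h3, norm_smul, norm_pow]
  exact mul_le_mul (pow_le_pow_left₀ (norm_nonneg _) hr1.le k) ((hc k).trans h2)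
    (norm_nonneg _) (by positivity)

lemma one_le_radius_powerSeries {a : ℕ → E}
    (ha : ∀ z : ℂ, ‖z‖ < 1 → Summable fun k : ℕ => z ^ k • a k) :
    1 ≤ (powerSeries a).radius := by
  refine ENNReal.le_of_forall_nnreal_lt fun r hr => ?_
  have hr1 : ‖((r : ℝ) : ℂ)‖ < 1 := by
    rw [Complex.norm_real, Real.norm_of_nonneg r.coe_nonneg]
    exact_mod_cast hr
  refine (powerSeries a).le_radius_of_tendsto (l := 0) ?_
  refine ((ha _ hr1).tendsto_atTop_zero.norm.congr fun k => ?_).trans (by simp)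
  rw [powerSeries, ContinuousMultilinearMap.norm_mkPiRing, norm_smul, norm_pow, Complex.norm_real,
    Real.norm_of_nonneg r.coe_nonneg, mul_comm]

lemma one_sub_smul_sum_pow_smul (c : ℕ → E) (z : ℂ) (m : ℕ) :
    (1 - z) • ∑ k ∈ Finset.range m, z ^ k • c k =
      c 0 + ∑ k ∈ Finset.range m, z ^ (k + 1) • (c (k + 1) - c k) - z ^ m • c m := by
  induction m with
  | zero => simp
  | succ m ih =>
    rw [Finset.sum_range_succ, smul_add, ih, Finset.sum_range_succ]
    module

/-- Abel summation: a power series whose coefficients tend to zero with summable increments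
converges on the closed unit disc off `1`, to a continuous function. -/
lemma exists_seriesTendsTo_continuousOn [CompleteSpace E] {c : ℕ → E} {u : ℕ → ℝ}
    (hc : Tendsto c atTop (𝓝 0)) (hu : Summable u) (hcu : ∀ k, ‖c (k + 1) - c k‖ ≤ u k) :
    ∃ S : ℂ → E, ContinuousOn S (Metric.closedBall 0 1 \ {1}) ∧
      ∀ z ∈ Metric.closedBall (0 : ℂ) 1 \ {1}, SeriesTendsTo (fun k => z ^ k • c k) (S z) := by
  have hbound : ∀ (k : ℕ) (z : ℂ), z ∈ Metric.closedBall (0 : ℂ) 1 →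
      ‖z ^ (k + 1) • (c (k + 1) - c k)‖ ≤ u k := by
    intro k z hz
    rw [mem_closedBall_zero_iff] at hz
    rw [norm_smul, norm_pow]
    exact (mul_le_of_le_one_left (norm_nonneg _) (pow_le_one₀ (norm_nonneg _) hz)).trans (hcu k)
  -- Summation by parts divided by `1 - z`: the remaining series is dominated by `u` uniformly on
  -- the closed disc.
  refine ⟨fun z => (1 - z)⁻¹ • (c 0 + ∑' k, z ^ (k + 1) • (c (k + 1) - c k)), ?_, ?_⟩
  · have h1 : ContinuousOn (fun z : ℂ => ∑' k, z ^ (k + 1) • (c (k + 1) - c k))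
        (Metric.closedBall 0 1) :=
      continuousOn_tsum (fun k => by fun_prop) hu hbound
    refine ContinuousOn.smul ?_ (continuousOn_const.add (h1.mono Set.sdiff_subset))
    refine ContinuousOn.inv₀ (by fun_prop) fun z hz => ?_
    exact sub_ne_zero.2 fun h => hz.2 h.symm
  · rintro z ⟨hz, hz1⟩
    have hz1' : 1 - z ≠ 0 := sub_ne_zero.2 fun h => hz1 h.symm
    have hsum : Summable fun k => z ^ (k + 1) • (c (k + 1) - c k) :=
      Summable.of_norm_bounded hu fun k => hbound k z hz
    have h0 : Tendsto (fun m => z ^ m • c m) atTop (𝓝 0) := by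
      refine squeeze_zero_norm (fun m => ?_) (by simpa using hc.norm)
      rw [norm_smul, norm_pow]
      exact mul_le_of_le_one_left (norm_nonneg _)
        (pow_le_one₀ (norm_nonneg _) (mem_closedBall_zero_iff.1 hz))
    have h2 := ((hsum.hasSum.tendsto_sum_nat.const_add (c 0)).sub h0).const_smul (1 - z)⁻¹
    rw [sub_zero] at h2
    refine h2.congr fun m => ?_
    rw [← one_sub_smul_sum_pow_smul, smul_smul, inv_mul_cancel₀ hz1', one_smul]

end Sequences

/-! ### Exponentials and the binomial series in a Banach algebra -/

section BanachAlgebra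

variable {A : Type*} [NormedRing A] [NormedAlgebra ℂ A] [CompleteSpace A]

lemma exp_add_smul (x : A) (s t : ℂ) :
    NormedSpace.exp ((s + t) • x) = NormedSpace.exp (s • x) * NormedSpace.exp (t • x) := by
  let _ := NormedAlgebra.restrictScalars ℚ ℂ A
  rw [add_smul]
  exact NormedSpace.exp_add_of_commute (((Commute.refl x).smul_left s).smul_right t)

lemma exp_smul_mul_exp_smul_neg (x : A) (s : ℂ) :
    NormedSpace.exp (s • x) * NormedSpace.exp (s • -x) = 1 := by
  rw [smul_neg, ← neg_smul, ← exp_add_smul]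
  simp

lemma exp_smul_sub_one (x : A) (s : ℂ) :
    NormedSpace.exp (s • (x - 1)) = Complex.exp (-s) • NormedSpace.exp (s • x) := by
  let _ := NormedAlgebra.restrictScalars ℚ ℂ A
  have h : s • (x - 1) = algebraMap ℂ A (-s) + s • x := by
    rw [Algebra.algebraMap_eq_smul_one]
    module
  rw [h, NormedSpace.exp_add_of_commute (Algebra.commutes _ _), ← NormedSpace.algebraMap_exp_comm,
    Complex.exp_eq_exp_ℂ, ← Algebra.smul_def]

lemma hasDerivAt_exp_log_one_add_smul (x : A) {t : ℝ} (ht : 0 ≤ t) :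
    HasDerivAt (fun t : ℝ => NormedSpace.exp ((Real.log (1 + t) : ℂ) • x))
      (((1 + t)⁻¹ : ℝ) • (x * NormedSpace.exp ((Real.log (1 + t) : ℂ) • x))) t := by
  have h1 : HasDerivAt (fun t : ℝ => Real.log (1 + t)) (1 + t)⁻¹ t := by
    simpa using ((hasDerivAt_id t).const_add 1).log (by simp; linarith)
  refine ((hasDerivAt_exp_smul_const' x (Real.log (1 + t) : ℂ)).scomp t
    h1.ofReal_comp).congr_deriv ?_
  simp only [Complex.coe_smul]

lemma exists_norm_exp_log_one_add_smul_le (x : A) :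
    ∃ K : ℝ, ∀ t ∈ Set.Icc (0 : ℝ) 1, ‖NormedSpace.exp ((Real.log (1 + t) : ℂ) • x)‖ ≤ K :=
  isCompact_Icc.exists_bound_of_continuousOn fun _ ht =>
    (hasDerivAt_exp_log_one_add_smul x ht.1).continuousAt.continuousWithinAt

lemma exists_norm_exp_log_one_add_smul_sub_one_le (x : A) :
    ∃ K : ℝ, 0 ≤ K ∧ ∀ t ∈ Set.Icc (0 : ℝ) 1,
      ‖NormedSpace.exp ((Real.log (1 + t) : ℂ) • x) - 1‖ ≤ K * t := by
  obtain ⟨K, hK⟩ := exists_norm_exp_log_one_add_smul_le x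
  have hK0 : 0 ≤ K := (norm_nonneg _).trans (hK 0 (by simp))
  refine ⟨‖x‖ * K, by positivity, fun t ht => ?_⟩
  have := norm_image_sub_le_of_norm_deriv_le_segment' (a := 0) (b := 1) (C := ‖x‖ * K)
    (fun s hs => (hasDerivAt_exp_log_one_add_smul x hs.1).hasDerivWithinAt) (fun s hs => ?_) t ht
  · simpa using this
  · rw [norm_smul, Real.norm_of_nonneg (inv_nonneg.2 (by linarith [hs.1]))]
    refine (mul_le_of_le_one_left (norm_nonneg _)
      (inv_le_one_of_one_le₀ (by linarith [hs.1]))).trans ?_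
    refine (norm_mul_le _ _).trans ?_
    gcongr
    exact hK s ⟨hs.1, hs.2.le⟩

/-- First-order terms cancel: the derivative of `(1 - t x) (1 + t) ^ x` is `-t / (1 + t) * (x + x ^
2) (1 + t) ^ x`, which vanishes at `0`. -/
lemma exists_norm_one_sub_smul_mul_exp_sub_one_le (x : A) :
    ∃ K : ℝ, 0 ≤ K ∧ ∀ t ∈ Set.Icc (0 : ℝ) 1,
      ‖(1 - (t : ℂ) • x) * NormedSpace.exp ((Real.log (1 + t) : ℂ) • x) - 1‖ ≤ K * t ^ 2 := by
  obtain ⟨K, hK⟩ := exists_norm_exp_log_one_add_smul_le x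
  have hK0 : 0 ≤ K := (norm_nonneg _).trans (hK 0 (by simp))
  refine ⟨‖x + x * x‖ * K, by positivity, fun t ht => ?_⟩
  have hd : ∀ s : ℝ, 0 ≤ s → HasDerivAt
      (fun s : ℝ => (1 - (s : ℂ) • x) * NormedSpace.exp ((Real.log (1 + s) : ℂ) • x))
      (-((s * (1 + s)⁻¹ : ℝ) • ((x + x * x) * NormedSpace.exp ((Real.log (1 + s) : ℂ) • x)))) s := by
    intro s hs
    have h1 : HasDerivAt (fun s : ℝ => 1 - (s : ℂ) • x) (-x) s := by
      simpa using ((Complex.ofRealCLM.hasDerivAt (x := s)).smul_const x).const_sub 1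
    have h2 := h1.mul (hasDerivAt_exp_log_one_add_smul x hs)
    refine h2.congr_deriv ?_
    set e := NormedSpace.exp ((Real.log (1 + s) : ℂ) • x)
    have hs' : (1 + s) ≠ 0 := by linarith
    have h3 : (s : ℂ) • x = s • x := by simp
    have h4 : (1 + s)⁻¹ = 1 - s * (1 + s)⁻¹ := by
      field_simp
      ring
    rw [h3]
    simp only [sub_mul, add_mul, neg_mul, one_mul, smul_mul_assoc, mul_smul_comm, smul_add,
      mul_assoc]
    generalize (1 + s)⁻¹ = u at h4 ⊢
    match_scalars
    · linear_combination h4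
    · ring
  -- The segment stops at `t`, so the factor `s ≤ t` of the derivative supplies the second power of
  -- `t`.
  have := norm_image_sub_le_of_norm_deriv_le_segment' (a := 0) (b := t)
    (C := t * (‖x + x * x‖ * K))
    (fun s hs => (hd s hs.1).hasDerivWithinAt) (fun s hs => ?_) t ⟨ht.1, le_rfl⟩
  · refine le_trans (by simpa using this) (le_of_eq (by ring))
  · have hs0 : 0 ≤ s := hs.1
    rw [norm_neg, norm_smul, Real.norm_of_nonneg (by positivity)]
    refine mul_le_mul ?_ ((norm_mul_le _ _).trans ?_) (norm_nonneg _) ht.1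
    · exact (mul_le_of_le_one_right hs0 (inv_le_one_of_one_le₀ (by linarith))).trans hs.2.le
    · gcongr
      exact hK s ⟨hs.1, hs.2.le.trans ht.2⟩

/-- The coefficients `∏ j ≤ k, (1 - x / j)` of the binomial series of `(1 - z) ^ (x - 1)`. -/
noncomputable def binomCoeff (x : A) : ℕ → A
  | 0 => 1
  | k + 1 => binomCoeff x k * (1 - ((k : ℂ) + 1)⁻¹ • x)

lemma one_sub_mem_slitPlane {z : ℂ} (hz : ‖z‖ ≤ 1) (hz1 : z ≠ 1) : 1 - z ∈ Complex.slitPlane := by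
  refine Or.inl ?_
  have h1 : z.re ≤ 1 := (Complex.re_le_norm z).trans hz
  rcases h1.lt_or_eq with h | h
  · simpa using h
  · refine absurd ?_ hz1
    have h2 : z.re * z.re + z.im * z.im ≤ 1 := by
      rw [← Complex.normSq_apply, Complex.normSq_eq_norm_sq]
      exact pow_le_one₀ (norm_nonneg _) hz
    have h3 : z.im = 0 := by
      rw [h] at h2
      nlinarith
    exact Complex.ext (by simp [h]) (by simp [h3])

lemma hasDerivAt_exp_log_one_sub_smul (x : A) {z : ℂ} (hz : 1 - z ∈ Complex.slitPlane) :
    HasDerivAt (fun z => NormedSpace.exp (Complex.log (1 - z) • x))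
      (-x * NormedSpace.exp (Complex.log (1 - z) • (x - 1))) z := by
  have h1 : HasDerivAt (fun z : ℂ => Complex.log (1 - z)) (-1 / (1 - z)) z :=
    ((hasDerivAt_id z).const_sub 1).clog hz
  refine ((hasDerivAt_exp_smul_const' x (Complex.log (1 - z))).scomp z h1).congr_deriv ?_
  rw [exp_smul_sub_one, Complex.exp_neg, Complex.exp_log (Complex.slitPlane_ne_zero hz),
    mul_smul_comm, neg_mul, smul_neg, neg_div, neg_smul, one_div]

/-- Each derivative lowers the exponent `x - 1 - k` by one and brings out `-(x - 1 - k) = (k + 1) (1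
- x / (k + 1))`. -/
lemma iteratedDeriv_exp_log_one_sub_smul (x : A) (k : ℕ) :
    ∀ z ∈ Metric.ball (0 : ℂ) 1,
      iteratedDeriv k (fun z => NormedSpace.exp (Complex.log (1 - z) • (x - 1))) z =
        (k.factorial : ℂ) • (binomCoeff x k *
          NormedSpace.exp (Complex.log (1 - z) • (x - 1 - (k : ℂ) • 1))) := by
  induction k with
  | zero => simp [binomCoeff]
  | succ k ih =>
    intro z hz
    have hz' : 1 - z ∈ Complex.slitPlane := by
      rw [mem_ball_zero_iff] at hz
      exact one_sub_mem_slitPlane hz.le (by rintro rfl; simp at hz)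
    have hd := ((hasDerivAt_exp_log_one_sub_smul (x - 1 - (k : ℂ) • 1) hz').const_mul
      (binomCoeff x k)).const_smul (k.factorial : ℂ)
    rw [iteratedDeriv_succ, (eventuallyEq_of_mem (Metric.isOpen_ball.mem_nhds hz) ih).deriv_eq]
    refine hd.deriv.trans ?_
    rw [binomCoeff]
    have hk : (k : ℂ) + 1 ≠ 0 := by exact_mod_cast k.succ_ne_zero
    have h1 : -(x - 1 - (k : ℂ) • 1) = ((k : ℂ) + 1) • (1 - ((k : ℂ) + 1)⁻¹ • x) := by
      rw [smul_sub, smul_smul, mul_inv_cancel₀ hk]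
      module
    have h2 : x - 1 - (k : ℂ) • (1 : A) - 1 = x - 1 - ((k + 1 : ℕ) : ℂ) • 1 := by
      push_cast
      module
    rw [h1, h2, Nat.factorial_succ, smul_mul_assoc, mul_smul_comm, smul_smul, mul_assoc]
    push_cast
    rw [mul_comm ((k : ℂ) + 1)]

/-- The binomial series in a Banach algebra. -/
lemma hasSum_binomCoeff (x : A) {z : ℂ} (hz : ‖z‖ < 1) :
    HasSum (fun k : ℕ => z ^ k • binomCoeff x k)
      (NormedSpace.exp (Complex.log (1 - z) • (x - 1))) := by
  have hd : DifferentiableOn ℂ (fun z => NormedSpace.exp (Complex.log (1 - z) • (x - 1)))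
      (Metric.ball 0 1) := by
    intro w hw
    rw [mem_ball_zero_iff] at hw
    exact (hasDerivAt_exp_log_one_sub_smul _ (one_sub_mem_slitPlane hw.le
      (by rintro rfl; simp at hw))).differentiableAt.differentiableWithinAt
  refine (Complex.hasSum_taylorSeries_on_ball hd (mem_ball_zero_iff.2 hz)).congr_fun fun k => ?_
  rw [iteratedDeriv_exp_log_one_sub_smul x k 0 (by simp), sub_zero, smul_comm, smul_smul,
    ← smul_assoc]
  simp [Nat.factorial_ne_zero]

end BanachAlgebra

/-! ### Numerical range and semigroup bounds -/

section Hilbert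

variable {H : Type*} [NormedAddCommGroup H] [InnerProductSpace ℂ H]

/-- A lower bound on the numerical range of `N` bounds the semigroup generated by `-N`. -/
lemma norm_exp_smul_neg_le [CompleteSpace H] {N : H →L[ℂ] H} {ϱ : ℝ}
    (hN : ∀ x : H, ϱ * ‖x‖ ^ 2 ≤ (inner ℂ x (N x)).re) {t : ℝ} (ht : 0 ≤ t) :
    ‖NormedSpace.exp ((t : ℂ) • -N)‖ ≤ Real.exp (-ϱ * t) := by
  refine ContinuousLinearMap.opNorm_le_bound _ (Real.exp_nonneg _) fun x => ?_
  set y : ℝ → H := fun s => NormedSpace.exp ((s : ℂ) • -N) x with hy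
  have hy' : ∀ s, HasDerivAt y (-(N (y s))) s := by
    intro s
    have h1 := (hasDerivAt_exp_smul_const' (-N) (s : ℂ)).clm_apply
      (hasDerivAt_const (s : ℂ) x)
    have h2 := h1.scomp s (Complex.ofRealCLM.hasDerivAt (x := s))
    refine h2.congr_deriv ?_
    simp [hy]
  -- Energy estimate: `exp (2 ϱ s) ‖y s‖ ^ 2` is nonincreasing, as `‖y‖ ^ 2` has derivative `-2 Re
  -- ⟪y, N y⟫ ≤ -2 ϱ ‖y‖ ^ 2`.
  have hφ : ∀ s, HasDerivAt (fun s => Real.exp (2 * ϱ * s) * (inner ℂ (y s) (y s)).re)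
      (Real.exp (2 * ϱ * s) * (2 * (ϱ * ‖y s‖ ^ 2 - (inner ℂ (y s) (N (y s))).re))) s := by
    intro s
    have h1 : HasDerivAt (fun s => Real.exp (2 * ϱ * s)) (Real.exp (2 * ϱ * s) * (2 * ϱ)) s := by
      simpa using ((hasDerivAt_id s).const_mul (2 * ϱ)).exp
    have h2 := Complex.reCLM.hasFDerivAt.comp_hasDerivAt s ((hy' s).inner ℂ (hy' s))
    refine (h1.mul h2).congr_deriv ?_
    have h3 : (inner ℂ (N (y s)) (y s)).re = (inner ℂ (y s) (N (y s))).re :=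
      inner_re_symm (𝕜 := ℂ) _ _
    have h4 : (inner ℂ (y s) (y s)).re = ‖y s‖ ^ 2 := inner_self_eq_norm_sq (𝕜 := ℂ) _
    simp only [Complex.reCLM_apply, Complex.add_re, inner_neg_left, inner_neg_right,
      Complex.neg_re, Function.comp_apply, h3, h4]
    ring
  have hanti := antitone_of_hasDerivAt_nonpos hφ fun s =>
    mul_nonpos_of_nonneg_of_nonpos (Real.exp_nonneg _) (by linarith [hN (y s)])
  have h0 := hanti ht
  have h4 : ∀ s, (inner ℂ (y s) (y s)).re = ‖y s‖ ^ 2 := fun s => inner_self_eq_norm_sq (𝕜 := ℂ) _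
  simp only [h4, mul_zero, Real.exp_zero, one_mul] at h0
  have hy0 : y 0 = x := by simp [hy]
  rw [hy0] at h0
  change ‖y t‖ ≤ _
  refine (pow_le_pow_iff_left₀ (norm_nonneg _) (by positivity) two_ne_zero).1 ?_
  calc ‖y t‖ ^ 2 = Real.exp (-ϱ * t) ^ 2 * (Real.exp (2 * ϱ * t) * ‖y t‖ ^ 2) := by
        rw [← Real.exp_nat_mul, ← mul_assoc, ← Real.exp_add]
        push_cast
        ring_nf
        simp
    _ ≤ Real.exp (-ϱ * t) ^ 2 * ‖x‖ ^ 2 := by gcongr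
    _ = _ := by ring

/-- The essential infimum of the real part of the singular value function of `N` is a lower bound
on the numerical range of `N`. -/
lemma HasSingularValueFunction.essInf_mul_le {V : Type*} [MeasurableSpace V] {N : H →L[ℂ] H}
    {ξ : Measure V} {n : V → ℂ} {U : H ≃ₗᵢ[ℂ] Lp ℂ 2 ξ}
    (hn : HasSingularValueFunction N ξ n U) (x : H) :
    essInf (fun v => (n v).re) ξ * ‖x‖ ^ 2 ≤ (inner ℂ x (N x)).re := by
  set ϱ := essInf (fun v => (n v).re) ξ
  -- A real-valued `essInf` is known to be an a.e. lower bound only once essential boundedness below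
  -- is checked.
  have hbd : IsBoundedUnder (· ≥ ·) (ae ξ) fun v => (n v).re := by
    refine isBoundedUnder_of_eventually_ge (a := -(eLpNormEssSup n ξ).toReal) ?_
    filter_upwards [ae_le_eLpNormEssSup (f := n) (μ := ξ)] with v hv
    have h1 := hn.1.eLpNorm_lt_top
    rw [eLpNorm_exponent_top] at h1
    have h2 := ENNReal.toReal_mono h1.ne hv
    rw [toReal_enorm] at h2
    linarith [neg_le_of_abs_le (Complex.abs_re_le_norm (n v))]
  have hae : ∀ᵐ v ∂ξ, ϱ ≤ (n v).re := ae_essInf_le hbd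
  have h1 : (inner ℂ x (N x)).re = ∫ v, (inner ℂ (U x v) (U (N x) v)).re ∂ξ := by
    rw [← U.inner_map_map, L2.inner_def]
    exact (integral_re (𝕜 := ℂ) (L2.integrable_inner (𝕜 := ℂ) (U x) (U (N x)))).symm
  have h2 : ‖x‖ ^ 2 = ∫ v, (inner ℂ (U x v) (U x v)).re ∂ξ := by
    rw [← U.norm_map, ← inner_self_eq_norm_sq (𝕜 := ℂ), L2.inner_def]
    exact (integral_re (𝕜 := ℂ) (L2.integrable_inner (𝕜 := ℂ) (U x) (U x))).symm
  have h3 := hn.2 (U x)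
  rw [U.symm_apply_apply] at h3
  rw [h1, h2, ← integral_const_mul]
  refine integral_mono_ae ((L2.integrable_inner (𝕜 := ℂ) (U x) (U x)).re.const_mul _)
    (L2.integrable_inner (𝕜 := ℂ) (U x) (U (N x))).re ?_
  filter_upwards [hae, h3] with v hv1 hv2
  have h4 : (inner ℂ (U x v) (U x v)).re = ‖U x v‖ ^ 2 :=
    inner_self_eq_norm_sq (𝕜 := ℂ) (U x v)
  have h5 : (inner ℂ (U x v) (U (N x) v)).re = (n v).re * ‖U x v‖ ^ 2 := by
    have h6 : inner ℂ (U x v) (U x v) = ((‖U x v‖ ^ 2 : ℝ) : ℂ) := by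
      rw [Complex.ofReal_pow]
      exact inner_self_eq_norm_sq_to_K (𝕜 := ℂ) (U x v)
    rw [hv2, ← smul_eq_mul, inner_smul_right, h6, Complex.re_mul_ofReal]
  change ϱ * (inner ℂ (U x v) (U x v)).re ≤ (inner ℂ (U x v) (U (N x) v)).re
  rw [h4, h5]
  gcongr

end Hilbert

/-! ### Asymptotics of the operator powers of `k + 1` -/

section OperatorPower

variable {H : Type*} [NormedAddCommGroup H] [InnerProductSpace ℂ H]

lemma opPow_natCast_add_one (k : ℕ) (D : H →L[ℂ] H) :
    opPow ((k : ℂ) + 1) D = NormedSpace.exp ((Real.log ((k : ℝ) + 1) : ℂ) • D) := by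
  rw [opPow, Complex.ofReal_log (by positivity)]
  push_cast
  rfl

variable [CompleteSpace H]

lemma opPow_natCast_succ_add_one (k : ℕ) (D : H →L[ℂ] H) :
    opPow (((k + 1 : ℕ) : ℂ) + 1) D = opPow ((k : ℂ) + 1) D *
      NormedSpace.exp ((Real.log (1 + 1 / ((k : ℝ) + 1)) : ℂ) • D) := by
  have hk : (0 : ℝ) < (k : ℝ) + 1 := by positivity
  have h : Real.log (((k + 1 : ℕ) : ℝ) + 1) =
      Real.log ((k : ℝ) + 1) + Real.log (1 + 1 / ((k : ℝ) + 1)) := by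
    rw [← Real.log_mul (by positivity) (by positivity)]
    congr 1
    push_cast
    field_simp
  rw [opPow_natCast_add_one, opPow_natCast_add_one, h, Complex.ofReal_add, exp_add_smul]

lemma opPow_mul_opPow_neg (k : ℕ) (D : H →L[ℂ] H) :
    opPow ((k : ℂ) + 1) D * opPow ((k : ℂ) + 1) (-D) = 1 :=
  exp_smul_mul_exp_smul_neg _ _

lemma one_div_natCast_add_one_mem_Icc (k : ℕ) : 1 / ((k : ℝ) + 1) ∈ Set.Icc (0 : ℝ) 1 :=
  ⟨by positivity, by
    rw [div_le_one (by positivity)]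
    linarith [k.cast_nonneg (α := ℝ)]⟩

/-- The binomial coefficients of `N` are asymptotic to `C (k + 1) ^ (-N)` for an operator `C`,
which is a reciprocal Gamma value of `N`. -/
lemma exists_norm_binomCoeff_mul_opPow_sub_le (N : H →L[ℂ] H) :
    ∃ (C : H →L[ℂ] H) (M : ℝ), 0 ≤ M ∧
      ∀ k : ℕ, ‖binomCoeff N k * opPow ((k : ℂ) + 1) N - C‖ ≤ M / ((k : ℝ) + 1) := by
  obtain ⟨K, hK0, hK⟩ := exists_norm_one_sub_smul_mul_exp_sub_one_le N
  refine exists_norm_sub_le_of_norm_succ_sub_le hK0 fun k => ?_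
  have hcomm : Commute (1 - ((k : ℂ) + 1)⁻¹ • N) (opPow ((k : ℂ) + 1) N) := by
    refine (Commute.one_left _).sub_left (Commute.smul_left ?_ _)
    exact ((Commute.refl N).smul_right _).exp_right
  have hinv : ((k : ℂ) + 1)⁻¹ = ((1 / ((k : ℝ) + 1) : ℝ) : ℂ) := by
    push_cast
    rw [one_div]
  -- The relative increment is `(1 - t N) (1 + t) ^ N - 1` at `t = 1 / (k + 1)`.
  have h1 : binomCoeff N (k + 1) * opPow (((k + 1 : ℕ) : ℂ) + 1) N -
      binomCoeff N k * opPow ((k : ℂ) + 1) N =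
      (binomCoeff N k * opPow ((k : ℂ) + 1) N) *
        ((1 - ((1 / ((k : ℝ) + 1) : ℝ) : ℂ) • N) *
          NormedSpace.exp ((Real.log (1 + 1 / ((k : ℝ) + 1)) : ℂ) • N) - 1) := by
    rw [opPow_natCast_succ_add_one, binomCoeff, ← hinv]
    generalize 1 - ((k : ℂ) + 1)⁻¹ • N = f at hcomm ⊢
    simp only [mul_sub, mul_one, mul_assoc]
    rw [← mul_assoc f, hcomm.eq, mul_assoc]
  rw [h1, mul_comm (K * _)]
  exact (norm_mul_le _ _).trans
    (mul_le_mul_of_nonneg_left (hK _ (one_div_natCast_add_one_mem_Icc k)) (norm_nonneg _))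

lemma norm_opPow_neg_le {N : H →L[ℂ] H} {ϱ : ℝ}
    (hN : ∀ x : H, ϱ * ‖x‖ ^ 2 ≤ (inner ℂ x (N x)).re) (k : ℕ) :
    ‖opPow ((k : ℂ) + 1) (-N)‖ ≤ ((k : ℝ) + 1) ^ (-ϱ) := by
  rw [opPow_natCast_add_one, Real.rpow_def_of_pos (by positivity), mul_comm]
  exact norm_exp_smul_neg_le hN (Real.log_nonneg (by linarith [k.cast_nonneg (α := ℝ)]))

lemma div_mul_rpow_neg (K ϱ : ℝ) (k : ℕ) :
    K / ((k : ℝ) + 1) * ((k : ℝ) + 1) ^ (-ϱ) = K * ((k : ℝ) + 1) ^ (-1 - ϱ) := by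
  rw [sub_eq_add_neg, Real.rpow_add (by positivity), Real.rpow_neg_one]
  ring

/-- The factor `(1 + 1 / (k + 1)) ^ (-N) - 1` gains `1 / (k + 1)` over the terms themselves, so
increments are summable for `ϱ > 0`, as Abel summation requires. -/
lemma exists_norm_opPow_neg_succ_sub_le {N : H →L[ℂ] H} {ϱ : ℝ}
    (hN : ∀ x : H, ϱ * ‖x‖ ^ 2 ≤ (inner ℂ x (N x)).re) :
    ∃ K : ℝ, ∀ k : ℕ, ‖opPow (((k + 1 : ℕ) : ℂ) + 1) (-N) - opPow ((k : ℂ) + 1) (-N)‖ ≤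
      K * ((k : ℝ) + 1) ^ (-1 - ϱ) := by
  obtain ⟨K, hK0, hK⟩ := exists_norm_exp_log_one_add_smul_sub_one_le (-N)
  refine ⟨K, fun k => ?_⟩
  have h := hK _ (one_div_natCast_add_one_mem_Icc k)
  rw [opPow_natCast_succ_add_one, ← mul_sub_one, ← div_mul_rpow_neg, mul_comm (K / _),
    div_eq_mul_one_div K]
  refine (norm_mul_le _ _).trans ?_
  exact mul_le_mul (norm_opPow_neg_le hN k) h (norm_nonneg _) (by positivity)

lemma summable_add_one_rpow {s : ℝ} (hs : s < -1) : Summable fun k : ℕ => ((k : ℝ) + 1) ^ s := by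
  have := (summable_nat_add_iff 1).2 (Real.summable_nat_rpow.2 hs)
  simpa using this

end OperatorPower

end Fiarma

/-! ### The main theorem -/

theorem mainTheorem7
    {H : Type*} [NormedAddCommGroup H] [InnerProductSpace ℂ H] [CompleteSpace H]
    [TopologicalSpace.SeparableSpace H]
    {V : Type*} [MeasurableSpace V] (ξ : Measure V) [SigmaFinite ξ]
    (N : H →L[ℂ] H) (hN : IsStarNormal N)
    (n : V → ℂ) (U : H ≃ₗᵢ[ℂ] Lp ℂ 2 ξ)
    (hn : Fiarma.HasSingularValueFunction N ξ n U)
    (ϱ : ℝ) (hϱ : ϱ = essInf (fun v => (n v).re) ξ) :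
    ∃ (C : H →L[ℂ] H) (Δ : ℕ → H →L[ℂ] H),
      ((fun k : ℕ => ‖Δ k‖) =O[atTop] fun k : ℕ => (k : ℝ) ^ (-1 - ϱ)) ∧
      1 ≤ (Fiarma.powerSeries fun k : ℕ => Fiarma.opPow ((k : ℂ) + 1) (-N)).radius ∧
      1 ≤ (Fiarma.powerSeries Δ).radius ∧
      (∀ z : ℂ, ‖z‖ < 1 →
        ∃ S T : H →L[ℂ] H,
          HasSum (fun k : ℕ => z ^ k • Fiarma.opPow ((k : ℂ) + 1) (-N)) S ∧
          HasSum (fun k : ℕ => z ^ k • Δ k) T ∧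
          Fiarma.opPow (1 - z) (N - ContinuousLinearMap.id ℂ H) = C ∘L S + T) ∧
      (0 < ϱ → ∀ z : ℂ, ‖z‖ ≤ 1 → z ≠ 1 →
        ∃ S T : H →L[ℂ] H,
          Fiarma.SeriesTendsTo (fun k : ℕ => z ^ k • Fiarma.opPow ((k : ℂ) + 1) (-N)) S ∧
          Fiarma.SeriesTendsTo (fun k : ℕ => z ^ k • Δ k) T ∧
          Fiarma.opPow (1 - z) (N - ContinuousLinearMap.id ℂ H) = C ∘L S + T) := by
  have hlow : ∀ x : H, ϱ * ‖x‖ ^ 2 ≤ (inner ℂ x (N x)).re := hϱ ▸ hn.essInf_mul_le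
  obtain ⟨C, M, hM0, hM⟩ := Fiarma.exists_norm_binomCoeff_mul_opPow_sub_le N
  set c : ℕ → H →L[ℂ] H := fun k => Fiarma.opPow ((k : ℂ) + 1) (-N) with hc
  set Δ : ℕ → H →L[ℂ] H := fun k => Fiarma.binomCoeff N k - C * c k with hΔ
  have hcn : ∀ k, ‖c k‖ ≤ ((k : ℝ) + 1) ^ (-ϱ) := Fiarma.norm_opPow_neg_le hlow
  have hΔn : ∀ k, ‖Δ k‖ ≤ M * ((k : ℝ) + 1) ^ (-1 - ϱ) := by
    intro k
    have h : Δ k = (Fiarma.binomCoeff N k * Fiarma.opPow ((k : ℂ) + 1) N - C) * c k := by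
      rw [sub_mul, mul_assoc, hc, Fiarma.opPow_mul_opPow_neg, mul_one]
    rw [h, ← Fiarma.div_mul_rpow_neg]
    exact (norm_mul_le _ _).trans
      (mul_le_mul (hM k) (hcn k) (norm_nonneg _) (by positivity))
  have hcs : ∀ z : ℂ, ‖z‖ < 1 → Summable fun k : ℕ => z ^ k • c k := fun z hz =>
    Fiarma.summable_pow_smul_of_norm_le_rpow hcn hz
  have hΔs : ∀ z : ℂ, ‖z‖ < 1 → HasSum (fun k : ℕ => z ^ k • Δ k)
      (Fiarma.opPow (1 - z) (N - 1) - C * ∑' k, z ^ k • c k) := by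
    intro z hz
    refine ((Fiarma.hasSum_binomCoeff N hz).sub ((hcs z hz).hasSum.mul_left C)).congr_fun
      fun k => ?_
    rw [hΔ, smul_sub, mul_smul_comm]
  refine ⟨C, Δ, ?_, Fiarma.one_le_radius_powerSeries hcs,
    Fiarma.one_le_radius_powerSeries fun z hz => (hΔs z hz).summable,
    fun z hz => ⟨_, _, (hcs z hz).hasSum, hΔs z hz, (add_sub_cancel _ _).symm⟩, ?_⟩
  · refine (IsBigO.of_bound M (Eventually.of_forall fun k => ?_)).trans
      (Fiarma.isBigO_add_one_rpow (-1 - ϱ))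
    rw [norm_norm, Real.norm_of_nonneg (by positivity)]
    exact hΔn k
  intro hϱ0 z hz hz1
  have hsum := Fiarma.summable_add_one_rpow (s := -1 - ϱ) (by linarith)
  obtain ⟨K, hK⟩ := Fiarma.exists_norm_opPow_neg_succ_sub_le hlow
  have hc0 : Tendsto c atTop (𝓝 0) := by
    refine squeeze_zero_norm hcn ?_
    exact (tendsto_rpow_neg_atTop hϱ0).comp
      (tendsto_atTop_add_const_right _ _ tendsto_natCast_atTop_atTop)
  obtain ⟨S, hS, hcS⟩ :=
    Fiarma.exists_seriesTendsTo_continuousOn hc0 (hsum.mul_left K) hK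
  have hΔb : ∀ (k : ℕ) (w : ℂ), w ∈ Metric.closedBall (0 : ℂ) 1 →
      ‖w ^ k • Δ k‖ ≤ M * ((k : ℝ) + 1) ^ (-1 - ϱ) := by
    intro k w hw
    rw [norm_smul, norm_pow]
    exact (mul_le_of_le_one_left (norm_nonneg _)
      (pow_le_one₀ (norm_nonneg _) (mem_closedBall_zero_iff.1 hw))).trans (hΔn k)
  have hT : ContinuousOn (fun w : ℂ => ∑' k, w ^ k • Δ k) (Metric.closedBall 0 1) :=
    continuousOn_tsum (fun k => by fun_prop) (hsum.mul_left M) hΔb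
  have hmem : z ∈ Metric.closedBall (0 : ℂ) 1 \ {1} := ⟨mem_closedBall_zero_iff.2 hz, hz1⟩
  have hΔz : Summable fun k : ℕ => z ^ k • Δ k :=
    Summable.of_norm_bounded (hsum.mul_left M) fun k => hΔb k z hmem.1
  refine ⟨S z, ∑' k, z ^ k • Δ k, hcS z hmem, hΔz.hasSum.tendsto_sum_nat, ?_⟩
  have hsub : Metric.ball (0 : ℂ) 1 ⊆ Metric.closedBall 0 1 \ {1} := fun w hw =>
    ⟨Metric.ball_subset_closedBall hw, by rintro rfl; simp at hw⟩
  -- The boundary identity is the limit, from within the open disc, of the identity already proved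
  -- there.
  have hG : ContinuousAt (fun w => Fiarma.opPow (1 - w) (N - 1)) z :=
    (Fiarma.hasDerivAt_exp_log_one_sub_smul (N - 1)
      (Fiarma.one_sub_mem_slitPlane hz hz1)).continuousAt
  have hR : ContinuousWithinAt (fun w => C * S w + ∑' k, w ^ k • Δ k) (Metric.ball 0 1) z :=
    (continuousWithinAt_const.mul ((hS z hmem).mono hsub)).add
      ((hT z hmem.1).mono Metric.ball_subset_closedBall)
  have hcl : z ∈ closure (Metric.ball (0 : ℂ) 1) := by
    rw [closure_ball _ one_ne_zero]
    exact hmem.1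
  have : (𝓝[Metric.ball (0 : ℂ) 1] z).NeBot := mem_closure_iff_nhdsWithin_neBot.1 hcl
  refine tendsto_nhds_unique (hG.continuousWithinAt (s := Metric.ball 0 1)) (hR.congr' ?_)
  filter_upwards [self_mem_nhdsWithin] with w hw
  have hw' := mem_ball_zero_iff.1 hw
  rw [(hΔs w hw').tsum_eq,
    tendsto_nhds_unique (hcS w (hsub hw)) (hcs w hw').hasSum.tendsto_sum_nat, add_sub_cancel]
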